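/- All graphs are finite, simple and undirected. The \emph{fork} is the graph obtained from the claw $K_{1,3}$ by subdividing one edge once; the \emph{bull} is the graph obtained from a triangle by attaching one pendant vertex to each of two of its vertices. A graph is \emph{(fork, bull)-free} if it contains neither the fork nor the bull as an induced subgraph. A \emph{hole of length $\ell$} is an induced cycle on $\ell\ge 5$ vertices. A set $S\subseteq V(G)$ is \emph{homogeneous} in $G$ if every vertex of $V(G)\setminus S$ is adjacent either to all vertices of $S$ or to none of them. A \emph{module} of $G$ is a homogeneous set $M$ such that every homogeneous set $S$ of $G$ satisfies $S\subseteq M$, $M\subseteq S$ or $S\cap M=\emptyset$. The graph $G$ is \emph{prime} if its only modules are $\emptyset$, the one-vertex sets and $V(G)$. \textbf{Theorem.} Let $G$ be a prime (fork, bull)-free graph that contains a hole of length $\ell$, where $\ell\ge 6$. Then $G$ is isomorphic to the cycle $C_\ell$ (that is, $G$ is itself a hole of length $\ell$), or $G$ is bipartite. -/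

import Mathlib

namespace ForkBull

/-- The fork: the claw with centre `0` and leaves `1`, `2`, `3`, in which a further vertex `4`
is attached to the leaf `3`. -/
def fork : SimpleGraph (Fin 5) :=
  SimpleGraph.fromEdgeSet {s(0, 1), s(0, 2), s(0, 3), s(3, 4)}

/-- The bull: the triangle `0`, `1`, `2` with a pendant vertex `3` attached to `0` and a pendant
vertex `4` attached to `1`. -/
def bull : SimpleGraph (Fin 5) :=
  SimpleGraph.fromEdgeSet {s(0, 1), s(0, 2), s(1, 2), s(0, 3), s(1, 4)}

variable {V : Type*}

/-- Every vertex outside `S` is complete or anticomplete to `S`. -/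
def IsHomogeneous (G : SimpleGraph V) (S : Set V) : Prop :=
  ∀ v ∉ S, (∀ s ∈ S, G.Adj v s) ∨ (∀ s ∈ S, ¬ G.Adj v s)

/-- A module is a homogeneous set that overlaps no other homogeneous set. -/
def IsModule (G : SimpleGraph V) (M : Set V) : Prop :=
  IsHomogeneous G M ∧ ∀ S : Set V, IsHomogeneous G S → S ⊆ M ∨ M ⊆ S ∨ S ∩ M = ∅

/-- A graph is prime if its only modules are the trivial ones: the empty set, the one-vertex sets
and the whole vertex set. -/
def IsPrime (G : SimpleGraph V) : Prop :=
  ∀ M : Set V, IsModule G M → M = ∅ ∨ (∃ v, M = {v}) ∨ M = Set.univ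

end ForkBull

namespace ForkBull

/-! ### Homogeneous sets of prime graphs -/

section Prime

variable {V : Type*} {G : SimpleGraph V}

/-! Primeness forces every homogeneous set to be trivial as soon as there is an edge and a non-edge
(`IsPrime.subsingleton_or_eq_univ`), so the proof exhibits homogeneous sets. Excluding fork and bull
leaves a vertex off the hole four possible traces: everything, nothing, three consecutive vertices
(a twin of the middle one), or, in a hexagon only, every other vertex (`IsTrace.classification`). A
hole vertex and its twins form a homogeneous set, so there are no twins. The hole together with the
alternating vertices is then homogeneous too, hence is all of `G`.

If no alternating vertex exists, `G` is the hole. Otherwise the hole is a hexagon; adjacent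
alternating vertices of the same type would span a nontrivial homogeneous component
(`IsHole.not_adj_of_alternating`), and the 2-colouring of the hexagon extends to `G`. -/

lemma IsHomogeneous.compl {S : Set V} (h : IsHomogeneous G S) : IsHomogeneous Gᶜ S := by
  intro v hv
  rcases h v hv with h | h
  · exact Or.inr fun s hs hc => ((SimpleGraph.compl_adj _ _ _).1 hc).2 (h s hs)
  · refine Or.inl fun s hs => (SimpleGraph.compl_adj _ _ _).2 ⟨?_, h s hs⟩
    rintro rfl
    exact hv hs

lemma isHomogeneous_compl {S : Set V} : IsHomogeneous Gᶜ S ↔ IsHomogeneous G S :=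
  ⟨fun h => by simpa using h.compl, fun h => h.compl⟩

lemma IsPrime.compl (h : IsPrime G) : IsPrime Gᶜ := by
  intro M hM
  refine h M ?_
  simpa only [IsModule, isHomogeneous_compl] using hM

/-- In a preconnected graph, a nonempty set closed under adjacency contains every vertex. -/
lemma mem_of_preconnected_of_closed (hG : G.Preconnected) {S : Set V} {a : V} (ha : a ∈ S)
    (hS : ∀ x ∈ S, ∀ y, G.Adj x y → y ∈ S) (b : V) : b ∈ S := by
  obtain ⟨p⟩ := hG a b
  induction p with
  | nil => exact ha
  | cons hadj _ ih => exact ih (hS _ ha _ hadj)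

/-- If a homogeneous set meets the component and also leaves it, a walk in the component cannot exit
the set: the exit vertex would be complete to the set, hence adjacent to a vertex of another
component. -/
lemma isModule_setOf_reachable (a : V) : IsModule G {y | G.Reachable a y} := by
  constructor
  · refine fun v hv => Or.inr fun s hs hvs => hv ?_
    exact SimpleGraph.Reachable.trans hs hvs.symm.reachable
  · intro S hS
    by_contra! hcon
    obtain ⟨hSK, hKS, w, hwS, hwK⟩ := hcon
    obtain ⟨s, hsS, hsK⟩ := Set.not_subset.1 hSK
    refine hKS fun k hk => ?_
    obtain ⟨p⟩ : G.Reachable w k := SimpleGraph.Reachable.trans hwK.symm hk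
    clear hk
    induction p with
    | nil => exact hwS
    | @cons u v _ hadj q ih =>
      have hvK : v ∈ {y | G.Reachable a y} := SimpleGraph.Reachable.trans hwK hadj.reachable
      refine ih ?_ hvK
      by_contra hvS
      rcases hS v hvS with h | h
      · exact hsK (SimpleGraph.Reachable.trans hvK (h s hsS).reachable)
      · exact h u hwS hadj.symm

lemma IsPrime.preconnected (h : IsPrime G) {a b : V} (hab : G.Adj a b) : G.Preconnected := by
  have key : {y | G.Reachable a y} = Set.univ := by
    have ha : a ∈ {y | G.Reachable a y} := SimpleGraph.Reachable.refl a
    have hb : b ∈ {y | G.Reachable a y} := hab.reachable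
    rcases h _ (isModule_setOf_reachable a) with h | ⟨v, h⟩ | h
    · rw [h] at ha
      exact ha.elim
    · rw [h, Set.mem_singleton_iff] at ha hb
      exact (hab.ne (ha.trans hb.symm)).elim
    · exact h
  intro x y
  have hx : G.Reachable a x := (Set.ext_iff.1 key x).2 trivial
  have hy : G.Reachable a y := (Set.ext_iff.1 key y).2 trivial
  exact hx.symm.trans hy

lemma IsHomogeneous.union {S T : Set V} (hS : IsHomogeneous G S) (hT : IsHomogeneous G T)
    (hST : (S ∩ T).Nonempty) : IsHomogeneous G (S ∪ T) := by
  obtain ⟨w, hwS, hwT⟩ := hST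
  intro v hv
  rw [Set.mem_union, not_or] at hv
  rcases hS v hv.1 with h | h <;> rcases hT v hv.2 with h' | h'
  · exact Or.inl fun s hs => hs.elim (h s) (h' s)
  · exact (h' w hwT (h w hwS)).elim
  · exact (h w hwS (h' w hwT)).elim
  · exact Or.inr fun s hs => hs.elim (h s) (h' s)

/-- A prime graph that is neither edgeless nor complete has only trivial homogeneous sets. -/
lemma IsPrime.subsingleton_or_eq_univ [Finite V] (h : IsPrime G) {a b c d : V}
    (hab : G.Adj a b) (hcd : Gᶜ.Adj c d) {S : Set V} (hS : IsHomogeneous G S) :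
    S.Subsingleton ∨ S = Set.univ := by
  have hG := h.preconnected hab
  have hGc := h.compl.preconnected hcd
  by_contra! hcon
  obtain ⟨hS1, hSu⟩ := hcon
  obtain ⟨M, hSM, hM⟩ := (Set.toFinite
    {M : Set V | IsHomogeneous G M ∧ M ≠ Set.univ}).exists_le_maximal
    (show S ∈ {M : Set V | IsHomogeneous G M ∧ M ≠ Set.univ} from ⟨hS, hSu⟩)
  have hM1 : M.Nontrivial := hS1.mono hSM
  obtain ⟨⟨hMh, hMu⟩, hmax⟩ := hM
  have hnot : ¬ IsModule G M := by
    intro hmod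
    rcases h M hmod with h | ⟨v, h⟩ | h
    · exact hM1.nonempty.ne_empty h
    · exact hM1.ne_singleton h
    · exact hMu h
  rw [IsModule, not_and] at hnot
  have hno := hnot hMh
  push Not at hno
  obtain ⟨T, hT, hTM, hMT, w, hwT, hwM⟩ := hno
  -- `T` overlaps the maximal proper homogeneous set `M`, so their union, being homogeneous, is
  -- everything.
  have hun : M ∪ T = Set.univ := by
    by_contra hne
    exact hTM (Set.subset_union_right.trans
      (hmax ⟨hMh.union hT ⟨w, hwM, hwT⟩, hne⟩ Set.subset_union_left))
  have hMc : ∀ u, u ∉ M → u ∈ T := fun u hu =>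
    ((Set.ext_iff.1 hun u).2 trivial).resolve_left hu
  obtain ⟨m, hmM, hmT⟩ := Set.not_subset.1 hMT
  obtain ⟨u, huM⟩ := (Set.ne_univ_iff_exists_notMem M).1 hMu
  -- `m` is complete or anticomplete to `T`, which contains the complement of `M`. As `M` is
  -- homogeneous, all pairs between `M` and its complement behave like those at `m`, so `Gᶜ` or `G`
  -- is disconnected.
  rcases hT m hmT with hm | hm
  · refine huM (mem_of_preconnected_of_closed hGc hmM (fun x hx y hxy => ?_) u)
    by_contra hy
    rcases hMh y hy with h' | h'
    · exact ((SimpleGraph.compl_adj _ _ _).1 hxy).2 (h' x hx).symm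
    · exact h' m hmM (hm y (hMc y hy)).symm
  · refine huM (mem_of_preconnected_of_closed hG hmM (fun x hx y hxy => ?_) u)
    by_contra hy
    rcases hMh y hy with h' | h'
    · exact hm y (hMc y hy) (h' m hmM).symm
    · exact h' x hx hxy.symm

end Prime

/-! ### Recognising induced forks and bulls -/

section Forbidden

variable {V : Type*} {G : SimpleGraph V}

/-- Only `p ≠ q` has to be assumed: these two leaves are twins in the fork, and adjacencies separate
every other pair. -/
lemma fork_isIndContained {c p q r s : V} (hpq : p ≠ q) (hcp : G.Adj c p) (hcq : G.Adj c q)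
    (hcr : G.Adj c r) (hrs : G.Adj r s) (h1 : ¬ G.Adj p q) (h2 : ¬ G.Adj p r)
    (h3 : ¬ G.Adj q r) (h4 : ¬ G.Adj c s) (h5 : ¬ G.Adj p s) (h6 : ¬ G.Adj q s) :
    fork.IsIndContained G := by
  have hinj : Function.Injective ![c, p, q, r, s] := by
    intro i j hij
    fin_cases i <;> fin_cases j <;>
      first | rfl | (exfalso; simp at hij; subst hij; simp_all [G.adj_comm])
  refine ⟨⟨⟨![c, p, q, r, s], hinj⟩, ?_⟩⟩
  intro i j
  fin_cases i <;> fin_cases j <;> simp [fork, *, G.adj_comm]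

lemma bull_isIndContained {p q r s t : V} (hpq : G.Adj p q) (hpr : G.Adj p r) (hqr : G.Adj q r)
    (hps : G.Adj p s) (hqt : G.Adj q t) (h1 : ¬ G.Adj p t) (h2 : ¬ G.Adj q s)
    (h3 : ¬ G.Adj r s) (h4 : ¬ G.Adj r t) (h5 : ¬ G.Adj s t) :
    bull.IsIndContained G := by
  have hinj : Function.Injective ![p, q, r, s, t] := by
    intro i j hij
    fin_cases i <;> fin_cases j <;>
      first | rfl | (exfalso; simp at hij; subst hij; simp_all [G.adj_comm])
  refine ⟨⟨⟨![p, q, r, s, t], hinj⟩, ?_⟩⟩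
  intro i j
  fin_cases i <;> fin_cases j <;> simp [bull, *, G.adj_comm]

end Forbidden

/-! ### Traces of outside vertices on a hole, and twins -/

section Hole

variable {V A : Type*} [CommRing A] {G : SimpleGraph V} {e : A}

/-- `A` is a cyclic index set of length at least `6` in which `i + e` follows `i`. -/
structure IsStep (e : A) : Prop where
  one_ne : e ≠ 0
  two_ne : 2 * e ≠ 0
  three_ne : 3 * e ≠ 0
  four_ne : 4 * e ≠ 0
  five_ne : 5 * e ≠ 0
  reach : ∀ i j : A, ∃ n : ℕ, j = i + n * e

/-- `v` enumerates an induced cycle of `G` in cyclic order. -/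
structure IsHole (G : SimpleGraph V) (e : A) (v : A → V) : Prop where
  inj : Function.Injective v
  adj : ∀ i j, G.Adj (v i) (v j) ↔ j = i + e ∨ i = j + e

/-- The constraints that excluding the fork and the bull puts on the set of neighbours, along a
hole, of a vertex outside the hole. -/
structure IsTrace (e : A) (N : A → Prop) : Prop where
  run_two : ∀ i, N i → N (i + e) → N (i - e) ∨ N (i + 2 * e)
  run_start : ∀ i j, ¬ N i → N (i + e) → N (i + 2 * e) → N j →
    j = i - e ∨ j = i + e ∨ j = i + 2 * e ∨ j = i + 3 * e
  isolated_far : ∀ i j, N i → ¬ N (i - e) → ¬ N (i + e) → N j →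
    j = i ∨ j = i + 2 * e ∨ j = i - 2 * e
  isolated_near : ∀ i, N i → ¬ N (i - e) → ¬ N (i + e) → N (i + 2 * e)

lemma IsHole.isTrace (he : IsStep e) (hfork : ¬ fork.IsIndContained G)
    (hbull : ¬ bull.IsIndContained G) {v : A → V} (hv : IsHole G e v) {x : V}
    (hx : x ∉ Set.range v) : IsTrace e fun j => G.Adj x (v j) := by
  obtain ⟨h1, h2, h3, h4, h5, -⟩ := he
  have hadj := hv.adj
  have hxv : ∀ j, v j ≠ x := fun j h => hx ⟨j, h⟩
  refine ⟨?_, ?_, ?_, ?_⟩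
  · intro i hi hi'
    by_contra! hcon
    obtain ⟨ha, hb⟩ := hcon
    refine hbull (bull_isIndContained (p := v i) (q := v (i + e)) (r := x) (s := v (i - e))
      (t := v (i + 2 * e)) ?_ hi.symm hi'.symm ?_ ?_ ?_ ?_ ha hb ?_) <;> rw [hadj] <;> grind
  · intro i j h0 ha hb hj
    by_contra! hcon
    have hji : j ≠ i := fun h => h0 (h ▸ hj)
    refine hbull (bull_isIndContained (p := v (i + e)) (q := x) (r := v (i + 2 * e)) (s := v i)
      (t := v j) ha.symm ?_ hb ?_ hj ?_ h0 ?_ ?_ ?_) <;> rw [hadj] <;> grind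
  · intro i j hi ha hb hj
    by_contra! hcon
    have hja : j ≠ i - e := fun h => ha (h ▸ hj)
    have hjb : j ≠ i + e := fun h => hb (h ▸ hj)
    refine hfork (fork_isIndContained (c := v i) (p := v (i - e)) (q := v (i + e)) (r := x)
      (s := v j) ?_ ?_ ?_ hi.symm hj ?_ (fun h => ha h.symm) (fun h => hb h.symm) ?_ ?_ ?_)
    · rw [hv.inj.ne_iff]; grind
    all_goals rw [hadj]; grind
  · intro i hi ha hb
    by_contra hc
    refine hfork (fork_isIndContained (c := v i) (p := v (i - e)) (q := x) (r := v (i + e))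
      (s := v (i + 2 * e)) (hxv _) ?_ hi.symm ?_ ?_ (fun h => ha h.symm) ?_ hb ?_ ?_ hc)
    all_goals rw [hadj]; grind

/-- Isolation propagates in steps of `2 * e`: `i + 2 * e` is again isolated, so `i + 4 * e` is in
the trace, and `isolated_far` at `i` allows this only when `i + 4 * e = i - 2 * e`. -/
lemma IsTrace.of_isolated (he : IsStep e) {N : A → Prop} (hN : IsTrace e N) {i : A}
    (hi : N i) (ha : ¬ N (i - e)) (hb : ¬ N (i + e)) :
    6 * e = 0 ∧ ∀ j, N j ↔ j = i ∨ j = i + 2 * e ∨ j = i + 4 * e := by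
  obtain ⟨h1, h2, h3, h4, h5, -⟩ := he
  have hfar := fun j => hN.isolated_far i j hi ha hb
  have hi2 := hN.isolated_near i hi ha hb
  have hi3 : ¬ N (i + 3 * e) := fun h => by have := hfar _ h; grind
  have hi4 : N (i + 4 * e) := by
    have := hN.isolated_near (i + 2 * e) hi2 (by convert hb using 2; ring)
      (by convert hi3 using 2; ring)
    convert this using 1; ring
  have h6 : 6 * e = 0 := by have := hfar _ hi4; grind
  refine ⟨h6, fun j => ⟨fun hj => ?_, ?_⟩⟩
  · have := hfar j hj; grind
  · rintro (rfl | rfl | rfl) <;> assumption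

lemma IsStep.exists_not_and_succ (he : IsStep e) {N : A → Prop} (h1 : ∃ i, N i)
    (h2 : ∃ i, ¬ N i) : ∃ i, ¬ N i ∧ N (i + e) := by
  by_contra! hcon
  obtain ⟨i, hi⟩ := h1
  obtain ⟨j, hj⟩ := h2
  have key : ∀ n : ℕ, ¬ N (j + n * e) := by
    intro n
    induction n with
    | zero => simpa using hj
    | succ n ih =>
      convert hcon _ ih using 2
      push_cast
      ring
  obtain ⟨n, rfl⟩ := he.reach j i
  exact key n hi

lemma IsTrace.classification (he : IsStep e) {N : A → Prop} (hN : IsTrace e N) :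
    (∀ j, N j) ∨ (∀ j, ¬ N j) ∨ (∃ i, ∀ j, N j ↔ j = i - e ∨ j = i ∨ j = i + e) ∨
      (6 * e = 0 ∧ ∃ i, ∀ j, N j ↔ j = i ∨ j = i + 2 * e ∨ j = i + 4 * e) := by
  obtain ⟨h1, h2, h3, h4, h5, -⟩ := id he
  by_cases hall : ∀ j, N j
  · exact Or.inl hall
  by_cases hnone : ∀ j, ¬ N j
  · exact Or.inr (Or.inl hnone)
  push Not at hall hnone
  obtain ⟨i, hi, hi1⟩ := he.exists_not_and_succ hnone hall
  by_cases hi2 : N (i + 2 * e)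
  · refine Or.inr (Or.inr (Or.inl ⟨i + 2 * e, fun j => ?_⟩))
    have hst := fun j => hN.run_start i j hi hi1 hi2
    have hi3 : N (i + 3 * e) := by
      rcases hN.run_two (i + e) hi1 (by convert hi2 using 1; ring) with h | h
      · exact (hi (by convert h using 1; ring)).elim
      · convert h using 1; ring
    -- Otherwise `i - e` would be isolated, and the resulting alternating trace would omit `i + 2 *
    -- e`.
    have him : ¬ N (i - e) := by
      intro h
      have hmm : ¬ N (i - e - e) := fun h' => by have := hst _ h'; grind
      obtain ⟨h6, hiff⟩ := hN.of_isolated he h hmm (by simpa using hi)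
      have := (hiff _).1 hi2
      grind
    constructor
    · intro hj
      have hne : j ≠ i - e := fun h => him (h ▸ hj)
      have := hst j hj
      grind
    · rintro (rfl | rfl | rfl)
      · convert hi1 using 1; ring
      · exact hi2
      · convert hi3 using 1; ring
  · obtain ⟨h6, hiff⟩ := hN.of_isolated he hi1 (by simpa using hi) (by convert hi2 using 2; ring)
    exact Or.inr (Or.inr (Or.inr ⟨h6, _, hiff⟩))

lemma alternating_recenter (h6 : 6 * e = 0) {i k : A}
    (hi : i = k ∨ i = k + 2 * e ∨ i = k + 4 * e) (j : A) :
    (j = k ∨ j = k + 2 * e ∨ j = k + 4 * e) ↔ (j = i ∨ j = i + 2 * e ∨ j = i + 4 * e) := by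
  have h2 : k + 2 * e + 4 * e = k := by linear_combination h6
  have h4 : k + 4 * e + 2 * e = k := by linear_combination h6
  have h4' : k + 4 * e + 4 * e = k + 2 * e := by linear_combination h6
  have h2' : k + 2 * e + 2 * e = k + 4 * e := by ring
  rcases hi with rfl | rfl | rfl
  · rfl
  · rw [h2, h2']
    tauto
  · rw [h4, h4']
    tauto

/-- Two traces do not differ in exactly one index. -/
lemma IsTrace.not_remove (he : IsStep e) {N N' : A → Prop} (hN : IsTrace e N)
    (hN' : IsTrace e N') {i : A} (h : ∀ j, N' j ↔ N j ∧ j ≠ i) (hi : N i) : False := by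
  obtain ⟨h1, h2, h3, h4, h5, -⟩ := id he
  rcases hN.classification he with hc | hc | ⟨k, hc⟩ | ⟨h6, k, hc⟩
  · simp only [hc] at h
    have := hN'.run_start i (i + 4 * e) (by rw [h]; grind) (by rw [h]; grind) (by rw [h]; grind)
      (by rw [h]; grind)
    grind
  · exact hc i hi
  · simp only [hc] at h hi
    rcases hi with rfl | rfl | rfl
    · have := hN'.run_two k (by rw [h]; grind) (by rw [h]; grind)
      rw [h, h] at this
      grind
    · have := hN'.isolated_near (i + e) (by rw [h]; grind) (by rw [h]; grind) (by rw [h]; grind)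
      rw [h] at this
      grind
    · have := hN'.run_two (k - e) (by rw [h]; grind) (by rw [h]; grind)
      rw [h, h] at this
      grind
  · simp only [alternating_recenter h6 ((hc i).1 hi)] at hc
    simp only [hc] at h hi
    -- Two steps of `isolated_near` lead from `i + 2 * e` to `i + 6 * e = i`, the removed index.
    have := hN'.isolated_near (i + 2 * e) (by rw [h]; grind) (by rw [h]; grind) (by rw [h]; grind)
    have h4i := hN'.isolated_near (i + 2 * e + 2 * e) this (by rw [h]; grind) (by rw [h]; grind)
    refine ((h _).1 h4i).2 ?_
    linear_combination h6

/-- Replacing a vertex of a hole by a twin yields a hole. -/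
lemma IsHole.update [DecidableEq A] (he : IsStep e) {v : A → V} (hv : IsHole G e v) {x : V}
    (hx : x ∉ Set.range v) {i : A} (hxi : ∀ j, G.Adj x (v j) ↔ j = i - e ∨ j = i ∨ j = i + e) :
    IsHole G e (Function.update v i x) := by
  have h1 := he.one_ne
  constructor
  · intro j k hjk
    by_cases hj : j = i <;> by_cases hk : k = i
    · exact hj.trans hk.symm
    · subst hj
      rw [Function.update_self, Function.update_of_ne hk] at hjk
      exact (hx ⟨k, hjk.symm⟩).elim
    · subst hk
      rw [Function.update_self, Function.update_of_ne hj] at hjk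
      exact (hx ⟨j, hjk⟩).elim
    · rw [Function.update_of_ne hk, Function.update_of_ne hj] at hjk
      exact hv.inj hjk
  · intro j k
    by_cases hj : j = i <;> by_cases hk : k = i
    · subst hj hk
      simp [h1]
    · subst hj
      rw [Function.update_self, Function.update_of_ne hk, hxi]
      grind
    · subst hk
      rw [Function.update_self, Function.update_of_ne hj, G.adj_comm, hxi]
      grind
    · rw [Function.update_of_ne hk, Function.update_of_ne hj, hv.adj]

/-- Swapping `v i` for its twin `x` gives another hole. The traces of `y` on the two holes agree off
`i`, so by `IsTrace.not_remove` they agree at `i` as well. -/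
lemma IsHole.adj_twin_iff (he : IsStep e) (hfork : ¬ fork.IsIndContained G)
    (hbull : ¬ bull.IsIndContained G) {v : A → V} (hv : IsHole G e v) {x y : V}
    (hx : x ∉ Set.range v) {i : A} (hxi : ∀ j, G.Adj x (v j) ↔ j = i - e ∨ j = i ∨ j = i + e)
    (hy : y ∉ Set.range v) (hxy : y ≠ x) : G.Adj y x ↔ G.Adj y (v i) := by
  classical
  have hN := hv.isTrace he hfork hbull hy
  have hy' : y ∉ Set.range (Function.update v i x) := by
    rintro ⟨j, hj⟩
    by_cases hji : j = i
    · subst hji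
      rw [Function.update_self] at hj
      exact hxy hj.symm
    · rw [Function.update_of_ne hji] at hj
      exact hy ⟨j, hj⟩
  have hN' := (hv.update he hx hxi).isTrace he hfork hbull hy'
  by_contra hne
  rw [not_iff] at hne
  by_cases hi : G.Adj y (v i)
  · refine hN.not_remove he hN' (i := i) (fun j => ?_) hi
    by_cases hji : j = i
    · subst hji
      simp only [Function.update_self]
      tauto
    · simp [hji]
  · refine hN'.not_remove he hN (i := i) (fun j => ?_) ?_
    · by_cases hji : j = i
      · subst hji
        simp only [Function.update_self]
        tauto
      · simp [hji]
    · simp only [Function.update_self]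
      tauto

/-- A vertex of a hole forms a homogeneous set together with its twins. -/
lemma IsHole.isHomogeneous_twins (he : IsStep e) (hfork : ¬ fork.IsIndContained G)
    (hbull : ¬ bull.IsIndContained G) {v : A → V} (hv : IsHole G e v) (i : A) :
    IsHomogeneous G (insert (v i) {x | x ∉ Set.range v ∧
      ∀ j, G.Adj x (v j) ↔ j = i - e ∨ j = i ∨ j = i + e}) := by
  intro y hy
  have key : ∀ s ∈ insert (v i) {x | x ∉ Set.range v ∧
      ∀ j, G.Adj x (v j) ↔ j = i - e ∨ j = i ∨ j = i + e}, (G.Adj y s ↔ G.Adj y (v i)) := by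
    rintro s (rfl | ⟨hs, hsi⟩)
    · rfl
    by_cases hyr : y ∈ Set.range v
    · obtain ⟨j, rfl⟩ := hyr
      have hji : j ≠ i := by
        rintro rfl
        exact hy (Set.mem_insert _ _)
      rw [G.adj_comm, hsi, hv.adj]
      grind
    · refine hv.adj_twin_iff he hfork hbull hs hsi hyr ?_
      rintro rfl
      exact hy (Or.inr ⟨hs, hsi⟩)
  by_cases h : G.Adj y (v i)
  · exact Or.inl fun s hs => (key s hs).2 h
  · exact Or.inr fun s hs hys => h ((key s hs).1 hys)

/-- In a graph with only trivial homogeneous sets, a vertex outside a hole is complete or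
anticomplete to the hole, or the hole has length `6` and the vertex sees every other vertex. -/
lemma IsHole.classification (he : IsStep e) (hfork : ¬ fork.IsIndContained G)
    (hbull : ¬ bull.IsIndContained G)
    (hG : ∀ S : Set V, IsHomogeneous G S → S.Subsingleton ∨ S = Set.univ)
    {v : A → V} (hv : IsHole G e v) {x : V} (hx : x ∉ Set.range v) :
    (∀ j, G.Adj x (v j)) ∨ (∀ j, ¬ G.Adj x (v j)) ∨
      (6 * e = 0 ∧ ∃ i, ∀ j, G.Adj x (v j) ↔ j = i ∨ j = i + 2 * e ∨ j = i + 4 * e) := by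
  rcases (hv.isTrace he hfork hbull hx).classification he with h | h | ⟨i, h⟩ | h
  · exact Or.inl h
  · exact Or.inr (Or.inl h)
  · exfalso
    rcases hG _ (hv.isHomogeneous_twins he hfork hbull i) with hs | hs
    · exact hx ⟨i, hs (Set.mem_insert _ _) (Set.mem_insert_of_mem _ ⟨hx, h⟩)⟩
    · have hmem := Set.mem_univ (v (i + e))
      rw [← hs] at hmem
      rcases hmem with h' | h'
      · exact he.one_ne (by simpa using hv.inj h')
      · exact h'.1 ⟨_, rfl⟩
  · exact Or.inr (Or.inr h)

end Hole

/-! ### Alternating vertices against complete and anticomplete ones -/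

section Alternating

variable {V A : Type*} [CommRing A] {G : SimpleGraph V} {e : A}

lemma IsHole.complete_adj_alternating (he : IsStep e) (hbull : ¬ bull.IsIndContained G)
    {v : A → V} (hv : IsHole G e v) {a b : V} (ha : ∀ j, G.Adj a (v j)) {i : A}
    (hb : ∀ j, G.Adj b (v j) ↔ j = i ∨ j = i + 2 * e ∨ j = i + 4 * e) : G.Adj a b := by
  obtain ⟨h1, h2, h3, h4, h5, -⟩ := he
  by_contra hab
  refine hbull (bull_isIndContained (p := v i) (q := a) (r := v (i + e)) (s := b)
    (t := v (i + 3 * e)) (ha _).symm ?_ (ha _) ?_ (ha _) ?_ hab ?_ ?_ ?_)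
  · rw [hv.adj]; grind
  · rw [G.adj_comm, hb]; grind
  · rw [hv.adj]; grind
  · rw [G.adj_comm, hb]; grind
  · rw [hv.adj]; grind
  · rw [hb]; grind

lemma IsHole.anticomplete_not_adj_alternating (he : IsStep e) (hfork : ¬ fork.IsIndContained G)
    {v : A → V} (hv : IsHole G e v) {z b : V} (hz : ∀ j, ¬ G.Adj z (v j)) {i : A}
    (hb : ∀ j, G.Adj b (v j) ↔ j = i ∨ j = i + 2 * e ∨ j = i + 4 * e) : ¬ G.Adj z b := by
  obtain ⟨h1, h2, h3, h4, h5, -⟩ := he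
  intro hzb
  have hz' : ∀ j, ¬ G.Adj (v j) z := fun j h => hz j h.symm
  refine hfork (fork_isIndContained (c := v (i + 2 * e)) (p := v (i + e)) (q := v (i + 3 * e))
    (r := b) (s := z) ?_ ?_ ?_ ?_ hzb.symm ?_ ?_ ?_ (hz' _) (hz' _) (hz' _))
  · rw [hv.inj.ne_iff]; grind
  · rw [hv.adj]; grind
  · rw [hv.adj]; grind
  · rw [G.adj_comm, hb]; grind
  · rw [hv.adj]; grind
  · rw [G.adj_comm, hb]; grind
  · rw [G.adj_comm, hb]; grind

/-- In a graph with only trivial homogeneous sets, every vertex outside a hole sees every other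
vertex of it, and the hole has length `6` if there is such a vertex. -/
lemma IsHole.mem_range_or_alternating (he : IsStep e) (hfork : ¬ fork.IsIndContained G)
    (hbull : ¬ bull.IsIndContained G)
    (hG : ∀ S : Set V, IsHomogeneous G S → S.Subsingleton ∨ S = Set.univ)
    {v : A → V} (hv : IsHole G e v) (x : V) :
    x ∈ Set.range v ∨ (x ∉ Set.range v ∧ 6 * e = 0 ∧
      ∃ i, ∀ j, G.Adj x (v j) ↔ j = i ∨ j = i + 2 * e ∨ j = i + 4 * e) := by
  -- Any other vertex is complete or anticomplete to the hole, and the two preceding lemmas extend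
  -- this to the alternating vertices.
  have hH : IsHomogeneous G {x | x ∈ Set.range v ∨ (x ∉ Set.range v ∧ 6 * e = 0 ∧
      ∃ i, ∀ j, G.Adj x (v j) ↔ j = i ∨ j = i + 2 * e ∨ j = i + 4 * e)} := by
    intro y hy
    rw [Set.mem_ofPred_eq, not_or] at hy
    rcases hv.classification he hfork hbull hG hy.1 with h | h | h
    · refine Or.inl ?_
      rintro s (⟨j, rfl⟩ | ⟨-, -, i, hs⟩)
      · exact h j
      · exact hv.complete_adj_alternating he hbull h hs
    · refine Or.inr ?_
      rintro s (⟨j, rfl⟩ | ⟨-, -, i, hs⟩)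
      · exact h j
      · exact hv.anticomplete_not_adj_alternating he hfork h hs
    · exact (hy.2 ⟨hy.1, h⟩).elim
  rcases hG _ hH with h | h
  · have := hv.inj (h (Or.inl ⟨0, rfl⟩) (Or.inl ⟨e, rfl⟩))
    exact (he.one_ne this.symm).elim
  · exact (Set.ext_iff.1 h x).2 trivial

end Alternating

/-! ### Bipartiteness in the hexagon case -/

section Hexagon

variable {V : Type*} {G : SimpleGraph V}

/-- Vertices that see the same alternate vertices of a hexagon are not adjacent. -/
lemma IsHole.not_adj_of_alternating (hfork : ¬ fork.IsIndContained G)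
    (hG : ∀ S : Set V, IsHomogeneous G S → S.Subsingleton ∨ S = Set.univ)
    {v : ZMod 6 → V} (hv : IsHole G 1 v)
    (hall : ∀ x, x ∈ Set.range v ∨ (x ∉ Set.range v ∧
      ∃ i, ∀ j, G.Adj x (v j) ↔ j = i ∨ j = i + 2 ∨ j = i + 4))
    {i : ZMod 6} {b b' : V} (hbv : b ∉ Set.range v) (hbv' : b' ∉ Set.range v)
    (hb : ∀ j, G.Adj b (v j) ↔ j = i ∨ j = i + 2 ∨ j = i + 4)
    (hb' : ∀ j, G.Adj b' (v j) ↔ j = i ∨ j = i + 2 ∨ j = i + 4) : ¬ G.Adj b b' := by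
  intro hbb
  set B : Set V := {x | x ∉ Set.range v ∧ ∀ j, G.Adj x (v j) ↔ j = i ∨ j = i + 2 ∨ j = i + 4}
    with hB
  -- `K` is the component of `b` in `G[B]`; it will be homogeneous, though it contains the edge `b
  -- b'` and misses the hole.
  set K : Set V := {x | Relation.ReflTransGen (fun x y => y ∈ B ∧ G.Adj x y) b x} with hK
  have hKB : K ⊆ B := by
    intro x hx
    rcases Relation.ReflTransGen.cases_tail hx with h | ⟨_, _, h, _⟩
    · exact h ▸ ⟨hbv, hb⟩
    · exact h
  have hbK : b ∈ K := Relation.ReflTransGen.refl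
  have hbK' : b' ∈ K := Relation.ReflTransGen.single ⟨⟨hbv', hb'⟩, hbb⟩
  have hmix : ∀ y ∉ K, ∀ x ∈ K, ∀ x' ∈ K, G.Adj x x' → G.Adj y x → G.Adj y x' := by
    intro y hy x hx x' hx' hxx hyx
    by_contra hyx'
    have hxB := (hKB hx).2
    have hxB' := (hKB hx').2
    rcases hall y with ⟨j, rfl⟩ | ⟨hyv, k, hk⟩
    · rw [G.adj_comm, hxB] at hyx
      rw [G.adj_comm, hxB'] at hyx'
      exact hyx' hyx
    · by_cases hki : k = i ∨ k = i + 2 ∨ k = i + 4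
      · have hyB : y ∈ B := by
          refine ⟨hyv, fun j => ?_⟩
          rw [hk]
          clear * - hki
          revert i j k
          decide
        exact hy (Relation.ReflTransGen.tail hx ⟨hyB, hyx.symm⟩)
      -- Here `y` is alternating of the opposite type, so it sees `v (i + 1)` and `v (i + 3)`, which
      -- `x` and `x'` miss.
      · refine hfork (fork_isIndContained (c := y) (p := v (i + 1)) (q := v (i + 3)) (r := x)
          (s := x') ?_ ?_ ?_ hyx hxx ?_ ?_ ?_ hyx' ?_ ?_)
        · rw [hv.inj.ne_iff]
          clear * -
          revert i
          decide
        · rw [hk]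
          clear * - hki
          revert i k
          decide
        · rw [hk]
          clear * - hki
          revert i k
          decide
        · rw [hv.adj]
          clear * -
          revert i
          decide
        all_goals
          rw [G.adj_comm]
          first | rw [hxB] | rw [hxB']
          clear * -
          revert i
          decide
  have hhom : IsHomogeneous G K := by
    intro y hy
    have key : ∀ x ∈ K, (G.Adj y x ↔ G.Adj y b) := by
      intro x hx
      have hx' : Relation.ReflTransGen (fun x y => y ∈ B ∧ G.Adj x y) b x := hx
      clear hx
      induction hx' with
      | refl => rfl
      | @tail c d hc hcd ih =>
        have hd : d ∈ K := Relation.ReflTransGen.tail hc hcd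
        refine Iff.trans ⟨hmix y hy d hd c hc hcd.2.symm, hmix y hy c hc d hd hcd.2⟩ ih
    by_cases h : G.Adj y b
    · exact Or.inl fun s hs => (key s hs).2 h
    · exact Or.inr fun s hs hys => h ((key s hs).1 hys)
  rcases hG K hhom with h | h
  · exact hbb.ne (h hbK hbK')
  · exact (hKB ((Set.ext_iff.1 h (v 0)).2 trivial)).1 ⟨0, rfl⟩

lemma IsHole.isBipartite_of_hexagon (hfork : ¬ fork.IsIndContained G)
    (hG : ∀ S : Set V, IsHomogeneous G S → S.Subsingleton ∨ S = Set.univ)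
    {v : ZMod 6 → V} (hv : IsHole G 1 v)
    (hall : ∀ x, x ∈ Set.range v ∨ (x ∉ Set.range v ∧
      ∃ i, ∀ j, G.Adj x (v j) ↔ j = i ∨ j = i + 2 ∨ j = i + 4)) : G.IsBipartite := by
  classical
  -- The colour of a vertex records whether it has a neighbour among `v 0`, `v 2`, `v 4`.
  have hcv : ∀ j, (G.Adj (v j) (v 0) ∨ G.Adj (v j) (v 2) ∨ G.Adj (v j) (v 4)) ↔
      ¬ (j = 0 ∨ j = 2 ∨ j = 4) := by
    intro j
    simp only [hv.adj]
    revert j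
    decide
  have hca : ∀ x i, (∀ j, G.Adj x (v j) ↔ j = i ∨ j = i + 2 ∨ j = i + 4) →
      ((G.Adj x (v 0) ∨ G.Adj x (v 2) ∨ G.Adj x (v 4)) ↔ (i = 0 ∨ i = 2 ∨ i = 4)) := by
    intro x i hx
    simp only [hx]
    clear hx
    revert i
    decide
  have hmixed : ∀ x i j, (∀ j, G.Adj x (v j) ↔ j = i ∨ j = i + 2 ∨ j = i + 4) →
      G.Adj x (v j) → ((i = 0 ∨ i = 2 ∨ i = 4) ↔ (j = 0 ∨ j = 2 ∨ j = 4)) := by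
    intro x i j hx hxj
    rw [hx] at hxj
    clear hx
    revert i j
    decide
  have hcol : ∀ x y, G.Adj x y → ¬ ((G.Adj x (v 0) ∨ G.Adj x (v 2) ∨ G.Adj x (v 4)) ↔
      (G.Adj y (v 0) ∨ G.Adj y (v 2) ∨ G.Adj y (v 4))) := by
    intro x y hxy
    rcases hall x with ⟨j, rfl⟩ | ⟨hx, i, hi⟩ <;> rcases hall y with ⟨k, rfl⟩ | ⟨hy, k, hk⟩
    · rw [hcv, hcv]
      rw [hv.adj] at hxy
      revert j k
      decide
    · have := hmixed y k j hk hxy.symm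
      rw [hcv, hca y k hk]
      tauto
    · have := hmixed x i k hi hxy
      rw [hcv, hca x i hi]
      tauto
    · rw [hca x i hi, hca y k hk]
      intro hik
      refine hv.not_adj_of_alternating hfork hG hall hx hy hi (fun j => ?_) hxy
      rw [hk]
      clear * - hik
      revert i j k
      decide
  refine (SimpleGraph.Coloring.mk (α := Bool)
    (fun x => decide (G.Adj x (v 0) ∨ G.Adj x (v 2) ∨ G.Adj x (v 4))) ?_).colorable
  intro x y hxy heq
  exact hcol x y hxy (decide_eq_decide.1 heq)

end Hexagon

/-! ### Cycle graphs indexed by `ZMod l` -/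

section CycleGraph

variable {V : Type*} {G : SimpleGraph V} {l : ℕ}

lemma natCast_zmod_ne_zero {k : ℕ} (hk : k ≠ 0) (hkl : k < l) : (k : ZMod l) ≠ 0 := by
  rw [Ne, ZMod.natCast_eq_zero_iff]
  exact fun h => absurd (Nat.le_of_dvd (Nat.pos_of_ne_zero hk) h) (by omega)

lemma isStep_one_zmod (hl : 6 ≤ l) : IsStep (1 : ZMod l) := by
  have : NeZero l := ⟨by omega⟩
  refine ⟨?_, ?_, ?_, ?_, ?_, fun i j => ⟨(j - i).val, by simp⟩⟩
  · simpa using natCast_zmod_ne_zero (l := l) (k := 1) (by simp) (by omega)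
  · simpa using natCast_zmod_ne_zero (l := l) (k := 2) (by simp) (by omega)
  · simpa using natCast_zmod_ne_zero (l := l) (k := 3) (by simp) (by omega)
  · simpa using natCast_zmod_ne_zero (l := l) (k := 4) (by simp) (by omega)
  · simpa using natCast_zmod_ne_zero (l := l) (k := 5) (by simp) (by omega)

lemma cycleGraph_adj_zmod {n : ℕ} (i j : ZMod (n + 2)) :
    (SimpleGraph.cycleGraph (n + 2)).Adj (V := Fin (n + 2)) i j ↔ j = i + 1 ∨ i = j + 1 := by
  have h : (SimpleGraph.cycleGraph (n + 2)).Adj (V := Fin (n + 2)) i j ↔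
      i - j = 1 ∨ j - i = 1 := SimpleGraph.cycleGraph_adj
  rw [h, sub_eq_iff_eq_add', sub_eq_iff_eq_add', or_comm]

end CycleGraph

end ForkBull

theorem mainTheorem9 {V : Type*} [Finite V] (G : SimpleGraph V)
    (hprime : ForkBull.IsPrime G)
    (hfork : ¬ ForkBull.fork.IsIndContained G)
    (hbull : ¬ ForkBull.bull.IsIndContained G)
    (l : ℕ) (hl : 6 ≤ l)
    (hhole : (SimpleGraph.cycleGraph l).IsIndContained G) :
    Nonempty (G ≃g SimpleGraph.cycleGraph l) ∨ G.IsBipartite := by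
  obtain ⟨n, rfl⟩ : ∃ n, l = n + 2 := ⟨l - 2, by omega⟩
  obtain ⟨f⟩ := hhole
  let v : ZMod (n + 2) → V := fun i => f i
  have he := ForkBull.isStep_one_zmod hl
  have hv : ForkBull.IsHole G 1 v :=
    ⟨f.injective, fun i j => f.map_adj_iff.trans (ForkBull.cycleGraph_adj_zmod i j)⟩
  have hG : ∀ S : Set V, ForkBull.IsHomogeneous G S → S.Subsingleton ∨ S = Set.univ := by
    intro S hS
    refine hprime.subsingleton_or_eq_univ (a := v 0) (b := v 1) (c := v 0) (d := v 2) ?_ ?_ hS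
    · rw [hv.adj]
      simp
    · obtain ⟨h1, h2, h3, -⟩ := he
      rw [mul_one] at h2 h3
      rw [SimpleGraph.compl_adj, hv.inj.ne_iff, hv.adj]
      refine ⟨h2.symm, ?_⟩
      rintro (h | h)
      · exact h1 (by linear_combination h)
      · exact h3 (by linear_combination -h)
  have hall := hv.mem_range_or_alternating he hfork hbull hG
  by_cases hsurj : Function.Surjective v
  · exact Or.inl ⟨(RelIso.ofSurjective f hsurj).symm⟩
  · right
    rw [Function.Surjective] at hsurj
    push Not at hsurj
    obtain ⟨x, hx⟩ := hsurj
    have h6 : ((6 : ℕ) : ZMod (n + 2)) = 0 := by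
      rcases hall x with ⟨i, hi⟩ | ⟨-, h, -⟩
      · exact (hx i hi).elim
      · simpa using h
    rw [ZMod.natCast_eq_zero_iff] at h6
    obtain rfl : n = 4 := by
      have := Nat.le_of_dvd (by norm_num) h6
      omega
    refine hv.isBipartite_of_hexagon hfork hG fun x => ?_
    rcases hall x with h | ⟨h, -, i, hi⟩
    · exact Or.inl h
    · exact Or.inr ⟨h, i, fun j => by simpa only [mul_one] using hi j⟩
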